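/- Let $f\colon \mathsf B\to\mathsf C$ be a morphism of crossed modules of groups. A crossed module $\mathsf T$ is $f$-local if $\mathrm{Hom}(f,\mathsf T)$ is a bijection, and a morphism $g$ is an $f$-equivalence if $\mathrm{Hom}(g,\mathsf T)$ is a bijection for every $f$-local $\mathsf T$. Let $\mathsf L_f$, with coaugmentation $\ell\colon \mathrm{Id}\to\mathsf L_f$, be a localization functor at $f$. That is, $\mathsf L_f$ is an endofunctor of the category of crossed modules such that $\ell^{\mathsf L_f\mathsf T}$ and $\mathsf L_f\ell^{\mathsf T}$ are isomorphisms for every $\mathsf T$, the crossed modules $\mathsf T$ with $\ell^{\mathsf T}$ an isomorphism are exactly the $f$-local ones, and the morphisms that $\mathsf L_f$ sends to isomorphisms are exactly the $f$-equivalences. Suppose that every $\ell^{\mathsf T}\colon\mathsf T\to\mathsf L_f\mathsf T$ is a regular epimorphism and that every kernel $\ker(\ell^{\mathsf T})$ is $\mathsf L_f$-acyclic, i.e. $\mathsf L_f\ker(\ell^{\mathsf T})$ is trivial. Then $\mathsf L_f$ is a nullification functor. More precisely, choose generating sets of the groups $B_1,B_2,C_1,C_2$, and let $\kappa$ be any infinite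 cardinal that is at least the total number of chosen generators (for example, the first infinite cardinal greater than this number). Let $\mathsf A=\coprod_\alpha\mathsf A_\alpha$, where $\mathsf A_\alpha$ runs over representatives of all isomorphism classes of $\mathsf L_f$-acyclic crossed modules with fewer than $2^\kappa$ generators, i.e. such that their two groups have generating sets with fewer than $2^\kappa$ elements in total. Then this coproduct exists and $\mathsf L_f$, with coaugmentation $\ell$, is the nullification functor $\mathsf P_{\mathsf A}$, i.e. the localization functor at the morphism $\mathsf A\to 1$. -/

import Mathlib

open CategoryTheory

universe u

/-- A crossed module of groups: groups `T₁`, `T₂`, an action of `T₂` on `T₁` by group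
automorphisms, and an equivariant homomorphism `∂ : T₁ → T₂` satisfying the Peiffer identity. -/
structure XMod : Type (u + 1) where
  T₁ : Type u
  T₂ : Type u
  [group₁ : Group T₁]
  [group₂ : Group T₂]
  [action : MulDistribMulAction T₂ T₁]
  /-- The connecting morphism. -/
  bd : T₁ →* T₂
  bd_smul : ∀ (b : T₂) (t : T₁), bd (b • t) = b * bd t * b⁻¹
  peiffer : ∀ t s : T₁, bd t • s = t * s * t⁻¹

namespace XMod

attribute [instance] group₁ group₂ action

/-- A morphism of crossed modules: a pair of homomorphisms compatible with the connecting
morphisms and with the actions. -/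
@[ext]
structure Hom (N M : XMod.{u}) : Type u where
  hom₁ : N.T₁ →* M.T₁
  hom₂ : N.T₂ →* M.T₂
  bd_comm : ∀ t : N.T₁, M.bd (hom₁ t) = hom₂ (N.bd t)
  map_smul : ∀ (b : N.T₂) (t : N.T₁), hom₁ (b • t) = hom₂ b • hom₁ t

/-- The category of crossed modules. -/
instance : Category.{u} XMod.{u} where
  Hom := Hom
  id N :=
    { hom₁ := MonoidHom.id _
      hom₂ := MonoidHom.id _
      bd_comm := fun _ => rfl
      map_smul := fun _ _ => rfl }
  comp f g :=
    { hom₁ := g.hom₁.comp f.hom₁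
      hom₂ := g.hom₂.comp f.hom₂
      bd_comm := fun t => by simp [g.bd_comm, f.bd_comm]
      map_smul := fun b t => by simp [g.map_smul, f.map_smul] }

/-- The trivial crossed module `1`. -/
def one : XMod.{u} where
  T₁ := PUnit
  T₂ := PUnit
  action :=
    { smul := fun _ t => t
      one_smul := fun _ => rfl
      mul_smul := fun _ _ _ => rfl
      smul_mul := fun _ _ _ => rfl
      smul_one := fun _ => rfl }
  bd := 1
  bd_smul := fun _ _ => rfl
  peiffer := fun _ _ => rfl

/-- The morphism `A ⟶ 1`. -/
def toOne (A : XMod.{u}) : A ⟶ one :=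
  Hom.mk (N := A) (M := one) 1 1 (fun _ => rfl) (fun _ _ => rfl)

/-- The kernel of a morphism of crossed modules, formed levelwise, with the connecting morphism
and the action induced from the source. -/
def ker {N M : XMod.{u}} (f : N ⟶ M) : XMod.{u} where
  T₁ := (Hom.hom₁ f).ker
  T₂ := (Hom.hom₂ f).ker
  action :=
    { smul := fun b t => ⟨(b : N.T₂) • (t : N.T₁), by
        have ht : Hom.hom₁ f (t : N.T₁) = 1 := t.2
        rw [MonoidHom.mem_ker, Hom.map_smul, ht, smul_one]⟩
      one_smul := fun t => Subtype.ext (one_smul N.T₂ (t : N.T₁))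
      mul_smul := fun b c t => Subtype.ext (mul_smul (b : N.T₂) (c : N.T₂) (t : N.T₁))
      smul_mul := fun b s t => Subtype.ext (smul_mul' (b : N.T₂) (s : N.T₁) (t : N.T₁))
      smul_one := fun b => Subtype.ext (smul_one (b : N.T₂)) }
  bd := (N.bd.comp (Hom.hom₁ f).ker.subtype).codRestrict (Hom.hom₂ f).ker (fun t => by
    have ht : Hom.hom₁ f (t : N.T₁) = 1 := t.2
    simp [MonoidHom.mem_ker, ← Hom.bd_comm, ht])
  bd_smul := fun b t => Subtype.ext (N.bd_smul (b : N.T₂) (t : N.T₁))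
  peiffer := fun t s => Subtype.ext (N.peiffer (t : N.T₁) (s : N.T₁))

/-- `T` has `n` generators: there are generating sets of the groups `T₁` and `T₂` with `n`
elements in total. -/
def HasGenerators (T : XMod.{u}) (n : Cardinal.{u}) : Prop :=
  ∃ (S₁ : Set T.T₁) (S₂ : Set T.T₂),
    Subgroup.closure S₁ = ⊤ ∧ Subgroup.closure S₂ = ⊤ ∧ Cardinal.mk S₁ + Cardinal.mk S₂ = n

/-- `T` is local with respect to the morphism `f`: `Hom(f, T)` is a bijection. -/
def IsLocalFor {B C : XMod.{u}} (f : B ⟶ C) (T : XMod.{u}) : Prop :=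
  Function.Bijective (fun g : C ⟶ T => f ≫ g)

/-- `g` is an equivalence with respect to the morphism `f`: `Hom(g, T)` is a bijection for every
`f`-local `T`. -/
def IsEquivalenceFor {B C : XMod.{u}} (f : B ⟶ C) {N M : XMod.{u}} (g : N ⟶ M) : Prop :=
  ∀ T : XMod.{u}, IsLocalFor f T → Function.Bijective (fun h : M ⟶ T => g ≫ h)

/-- A localization functor: a coaugmented idempotent endofunctor of crossed modules. -/
structure LocalizationFunctor : Type (u + 1) where
  L : XMod.{u} ⥤ XMod.{u}
  /-- The coaugmentation. -/
  ell : 𝟭 XMod.{u} ⟶ L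
  isIso_ell_obj : ∀ X : XMod.{u}, IsIso (ell.app (L.obj X))
  isIso_map_ell : ∀ X : XMod.{u}, IsIso (L.map (ell.app X))

namespace LocalizationFunctor

variable (Λ : LocalizationFunctor.{u})

/-- The localization morphism `T ⟶ L T`. -/
def locMap (T : XMod.{u}) : T ⟶ Λ.L.obj T := Λ.ell.app T

/-- `T` is `L`-local. -/
def IsLocal (T : XMod.{u}) : Prop := IsIso (Λ.locMap T)

/-- `g` is an `L`-equivalence. -/
def IsEquivalence {N M : XMod.{u}} (g : N ⟶ M) : Prop := IsIso (Λ.L.map g)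

/-- `T` is `L`-acyclic: `L T` is trivial. -/
def IsAcyclic (T : XMod.{u}) : Prop := Nonempty (Λ.L.obj T ≅ one)

/-- `L` is a regular-epi localization. -/
def IsRegularEpiLocalization : Prop := ∀ T : XMod.{u}, IsRegularEpi (Λ.locMap T)

/-- `L` is the localization functor `L_f`: its local objects and its equivalences are the
`f`-local ones and the `f`-equivalences. -/
structure IsLocalizationAt {B C : XMod.{u}} (f : B ⟶ C) : Prop where
  isLocal_iff : ∀ T : XMod.{u}, Λ.IsLocal T ↔ IsLocalFor f T
  isEquivalence_iff : ∀ {N M : XMod.{u}} (g : N ⟶ M), Λ.IsEquivalence g ↔ IsEquivalenceFor f g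

/-- `L` is the nullification functor `P_A`, the localization functor of `A ⟶ 1`. -/
def IsNullification (A : XMod.{u}) : Prop := Λ.IsLocalizationAt (toOne A)

/-- `A` is the coproduct of all `L`-acyclic crossed modules with fewer than `c` generators, one
from each isomorphism class. -/
def IsCoproductOfAcyclics (c : Cardinal.{u}) (A : XMod.{u}) : Prop :=
  ∃ (ι : Type u) (X : ι → XMod.{u}) (incl : ∀ i, X i ⟶ A),
    (∀ i, Λ.IsAcyclic (X i) ∧ ∃ n < c, (X i).HasGenerators n) ∧
    (∀ T : XMod.{u}, Λ.IsAcyclic T → (∃ n < c, T.HasGenerators n) →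
      ∃! i, Nonempty (T ≅ X i)) ∧
    Nonempty (Limits.IsColimit (Limits.Cofan.mk A incl))

end LocalizationFunctor

end XMod

/-!
A localization functor `L` is determined by its local objects, so it suffices to show that the
`f`-local crossed modules `T` are those for which every morphism from an acyclic crossed module with
fewer than `2 ^ κ` generators is trivial; by the universal property of the coproduct these are the
`A ⟶ 1`-local ones.

A morphism from an acyclic `Y` to a local `T` factors through `L Y ≅ 1`, hence is trivial
(`LocalizationFunctor.IsAcyclic.hom_eq_trivialHom`).

Conversely, the kernels of `ℓ : B ⟶ L B` and `ℓ : C ⟶ L C` are acyclic by hypothesis, and they are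
small: `B` and `C` have at most `κ` generators with `κ` infinite, so their groups, and all subgroups
of these, have at most `κ < 2 ^ κ` elements (`ker_hasGenerators`). If `T` receives only trivial
morphisms from small acyclic crossed modules, then all morphisms `B ⟶ T` and `C ⟶ T` vanish on
these kernels, and so they factor uniquely through the regular epimorphisms `ℓ`
(`exists_factor_of_kerHom_comp_eq`). Hence `Hom(f, T)` is identified with `Hom(L f, T)`, a bijection
because `f` is an `L`-equivalence (`LocalizationFunctor.isLocalFor_of_factor`).

The coproduct `A` exists because there is only a set of isomorphism classes of crossed modules of
bounded size (`small_isoClasses`) and crossed modules have coproducts (`coprod`). The coproduct of a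
family `X i` has as base group the free product `G` of the base groups; its top group is presented
by the formal translates by elements of `G` of elements of the top groups, subject to the relations
that a crossed module under all the `X i` must satisfy.
-/

namespace XMod

/-! ### Morphisms of crossed modules -/

theorem hom_ext {N M : XMod.{u}} {f g : N ⟶ M} (h₁ : ∀ t, Hom.hom₁ f t = Hom.hom₁ g t)
    (h₂ : ∀ b, Hom.hom₂ f b = Hom.hom₂ g b) : f = g :=
  Hom.ext (MonoidHom.ext h₁) (MonoidHom.ext h₂)

/-- The morphism `1 ⟶ M`. -/
def fromOne (M : XMod.{u}) : one ⟶ M :=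
  Hom.mk (N := one) (M := M) 1 1 (fun _ => by simp) (fun _ _ => by simp)

theorem hom_to_one_ext {N : XMod.{u}} (f g : N ⟶ one) : f = g :=
  hom_ext (fun _ => Subsingleton.elim (α := PUnit) _ _)
    (fun _ => Subsingleton.elim (α := PUnit) _ _)

theorem hom_from_one_ext {M : XMod.{u}} (f g : one ⟶ M) : f = g :=
  hom_ext (fun t => by rw [show t = 1 from rfl, map_one, map_one])
    (fun t => by rw [show t = 1 from rfl, map_one, map_one])

/-- The trivial morphism. -/
def trivialHom (N M : XMod.{u}) : N ⟶ M := toOne N ≫ fromOne M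

@[simp]
theorem comp_trivialHom {N M P : XMod.{u}} (f : N ⟶ M) :
    f ≫ trivialHom M P = trivialHom N P :=
  hom_ext (fun _ => rfl) (fun _ => rfl)

/-- A morphism factoring through a crossed module isomorphic to `1` is trivial. -/
theorem comp_eq_trivialHom_of_iso_one {N Z M : XMod.{u}} (i : Z ≅ one) (f : N ⟶ Z) (g : Z ⟶ M) :
    f ≫ g = trivialHom N M := by
  have h₁ : f ≫ i.hom = toOne N := hom_to_one_ext _ _
  have h₂ : i.inv ≫ g = fromOne M := hom_from_one_ext _ _
  rw [trivialHom, ← h₁, ← h₂]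
  simp

/-- A crossed module is local with respect to `A ⟶ 1` when every morphism from `A` to it is
trivial. -/
theorem isLocalFor_toOne_iff {A T : XMod.{u}} :
    IsLocalFor (toOne A) T ↔ ∀ h : A ⟶ T, h = trivialHom A T := by
  constructor
  · intro hT h
    obtain ⟨g, rfl⟩ := hT.2 h
    rw [trivialHom, hom_from_one_ext g (fromOne T)]
  · intro hT
    exact ⟨fun _ _ _ => hom_from_one_ext _ _, fun h => ⟨fromOne T, (hT h).symm⟩⟩

/-- The inclusion of the kernel. -/
def kerHom {N M : XMod.{u}} (f : N ⟶ M) : ker f ⟶ N :=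
  Hom.mk (N := ker f) (M := N) (Hom.hom₁ f).ker.subtype (Hom.hom₂ f).ker.subtype
    (fun _ => rfl) (fun _ _ => rfl)

/-- A morphism that is trivial on the kernel of `p` factors through `p` if `p` is a regular
epimorphism: it identifies any two morphisms that `p` identifies, because their elementwise
quotients lie in the kernel. -/
theorem exists_factor_of_kerHom_comp_eq {N M T : XMod.{u}} (p : N ⟶ M) [IsRegularEpi p]
    (h : N ⟶ T) (hh : kerHom p ≫ h = trivialHom _ _) : ∃ k : M ⟶ T, p ≫ k = h := by
  have hk₁ : ∀ x y : N.T₁, Hom.hom₁ p x = Hom.hom₁ p y → Hom.hom₁ h x = Hom.hom₁ h y := by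
    intro x y hxy
    have hm : x * y⁻¹ ∈ (Hom.hom₁ p).ker := by simp [MonoidHom.mem_ker, hxy]
    have := congrArg (fun g : ker p ⟶ T => Hom.hom₁ g (⟨x * y⁻¹, hm⟩ : (Hom.hom₁ p).ker)) hh
    have h' : Hom.hom₁ h (x * y⁻¹) = 1 := this
    rwa [map_mul, map_inv, mul_inv_eq_one] at h'
  have hk₂ : ∀ x y : N.T₂, Hom.hom₂ p x = Hom.hom₂ p y → Hom.hom₂ h x = Hom.hom₂ h y := by
    intro x y hxy
    have hm : x * y⁻¹ ∈ (Hom.hom₂ p).ker := by simp [MonoidHom.mem_ker, hxy]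
    have := congrArg (fun g : ker p ⟶ T => Hom.hom₂ g (⟨x * y⁻¹, hm⟩ : (Hom.hom₂ p).ker)) hh
    have h' : Hom.hom₂ h (x * y⁻¹) = 1 := this
    rwa [map_mul, map_inv, mul_inv_eq_one] at h'
  refine ⟨IsRegularEpi.desc p h (hom_ext (fun t => hk₁ _ _ ?_) (fun b => hk₂ _ _ ?_)),
    IsRegularEpi.fac p h _⟩
  · exact congrArg (fun g => Hom.hom₁ g t) (IsRegularEpi.w p)
  · exact congrArg (fun g => Hom.hom₂ g b) (IsRegularEpi.w p)

/-! ### Coproducts of crossed modules -/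

section Coproduct

variable {ι : Type u} (X : ι → XMod.{u})

/-- The base group of the coproduct: the free product of the base groups. -/
abbrev CoprodBase : Type u := Monoid.CoprodI fun i => (X i).T₂

variable {X} in
/-- The inclusions into the free product of the base groups. -/
def baseOf (i : ι) : (X i).T₂ →* CoprodBase X := Monoid.CoprodI.of (M := fun i => (X i).T₂)

/-- The generators of the top group of the coproduct: a pair `(g, ⟨i, x⟩)` stands for the
translate by `g` of the image of `x`. -/
abbrev CoprodGen : Type u := CoprodBase X × Σ i, (X i).T₁

variable {X} in
/-- The connecting morphism of the coproduct on generators. -/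
def genBd (a : CoprodGen X) : CoprodBase X :=
  a.1 * baseOf a.2.1 ((X a.2.1).bd a.2.2) * a.1⁻¹

/-- The relations of the top group of the coproduct: the inclusions are homomorphisms, they are
equivariant, and generators satisfy the Peiffer identity. -/
inductive CoprodRel : FreeGroup (CoprodGen X) → Prop
  | mul (g : CoprodBase X) (i : ι) (x y : (X i).T₁) :
      CoprodRel (FreeGroup.of (g, ⟨i, x⟩) * FreeGroup.of (g, ⟨i, y⟩) *
        (FreeGroup.of (g, ⟨i, x * y⟩))⁻¹)
  | smul (g : CoprodBase X) (i : ι) (b : (X i).T₂) (x : (X i).T₁) :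
      CoprodRel (FreeGroup.of (g * baseOf i b, ⟨i, x⟩) *
        (FreeGroup.of (g, ⟨i, b • x⟩))⁻¹)
  | peiffer (a c : CoprodGen X) :
      CoprodRel (FreeGroup.of a * FreeGroup.of c * (FreeGroup.of a)⁻¹ *
        (FreeGroup.of (genBd a * c.1, c.2))⁻¹)

/-- The top group of the coproduct. -/
abbrev CoprodTop : Type u := PresentedGroup {r | CoprodRel X r}

variable {X}

/-- The class of a generator in the top group of the coproduct. -/
def topOf (a : CoprodGen X) : CoprodTop X := PresentedGroup.of a

/-- A map on generators respecting the three families of relations induces a homomorphism on the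
top group of the coproduct. -/
def topLift {G : Type u} [Group G] (φ : CoprodGen X → G)
    (hmul : ∀ g i x y, φ (g, ⟨i, x⟩) * φ (g, ⟨i, y⟩) = φ (g, ⟨i, x * y⟩))
    (hsmul : ∀ g i (b : (X i).T₂) x, φ (g * baseOf i b, ⟨i, x⟩) = φ (g, ⟨i, b • x⟩))
    (hpeiffer : ∀ a c, φ a * φ c * (φ a)⁻¹ = φ (genBd a * c.1, c.2)) : CoprodTop X →* G :=
  PresentedGroup.toGroup (f := φ) (by
    rintro r (⟨g, i, x, y⟩ | ⟨g, i, b, x⟩ | ⟨a, c⟩)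
    · simp [hmul]
    · simp [hsmul]
    · simp [← hpeiffer])

@[simp]
theorem topLift_topOf {G : Type u} [Group G] (φ : CoprodGen X → G) (hmul) (hsmul) (hpeiffer)
    (a : CoprodGen X) : topLift φ hmul hsmul hpeiffer (topOf a) = φ a :=
  PresentedGroup.toGroup.of _

theorem topOf_mul (g : CoprodBase X) (i : ι) (x y : (X i).T₁) :
    topOf (g, ⟨i, x⟩) * topOf (g, ⟨i, y⟩) = topOf (g, ⟨i, x * y⟩) :=
  PresentedGroup.mk_eq_mk_of_mul_inv_mem (CoprodRel.mul g i x y)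

theorem topOf_smul (g : CoprodBase X) (i : ι) (b : (X i).T₂) (x : (X i).T₁) :
    topOf (g * baseOf i b, ⟨i, x⟩) = topOf (g, ⟨i, b • x⟩) :=
  PresentedGroup.mk_eq_mk_of_mul_inv_mem (CoprodRel.smul g i b x)

theorem topOf_peiffer (a c : CoprodGen X) :
    topOf a * topOf c * (topOf a)⁻¹ = topOf (genBd a * c.1, c.2) :=
  PresentedGroup.mk_eq_mk_of_mul_inv_mem (CoprodRel.peiffer a c)

/-- The base group of the coproduct acts on the top group by translating generators. -/
def translate (h : CoprodBase X) : CoprodTop X →* CoprodTop X :=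
  topLift (fun a => topOf (h * a.1, a.2)) (fun g i x y => topOf_mul _ _ _ _)
    (fun g i b x => by rw [← mul_assoc, topOf_smul])
    (fun a c => by
      rw [topOf_peiffer]
      congr 2
      simp [genBd, mul_assoc])

@[simp]
theorem translate_topOf (h : CoprodBase X) (a : CoprodGen X) :
    translate h (topOf a) = topOf (h * a.1, a.2) :=
  topLift_topOf ..

theorem top_hom_ext {G : Type u} [Group G] {φ ψ : CoprodTop X →* G}
    (h : ∀ a, φ (topOf a) = ψ (topOf a)) : φ = ψ :=
  PresentedGroup.ext h

instance : MulDistribMulAction (CoprodBase X) (CoprodTop X) where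
  smul h t := translate h t
  one_smul t := by
    change translate 1 t = MonoidHom.id _ t
    congr 1
    exact top_hom_ext fun a => by simp
  mul_smul g h t := by
    change translate (g * h) t = (translate g).comp (translate h) t
    congr 1
    exact top_hom_ext fun a => by simp [mul_assoc]
  smul_mul h := map_mul (translate h)
  smul_one h := map_one (translate h)

@[simp]
theorem smul_topOf (h : CoprodBase X) (a : CoprodGen X) :
    h • topOf a = topOf (h * a.1, a.2) :=
  translate_topOf h a

/-- The connecting morphism of the coproduct. -/
def coprodBd : CoprodTop X →* CoprodBase X :=
  topLift genBd (fun g i x y => by simp [genBd])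
    (fun g i b x => by simp [genBd, bd_smul, mul_assoc])
    (fun a c => by simp [genBd, mul_assoc])

@[simp]
theorem coprodBd_topOf (a : CoprodGen X) : coprodBd (topOf a) = genBd a :=
  topLift_topOf ..

theorem coprodBd_smul (g : CoprodBase X) (t : CoprodTop X) :
    coprodBd (g • t) = g * coprodBd t * g⁻¹ := by
  change (coprodBd.comp (translate g)) t = ((MulAut.conj g).toMonoidHom.comp coprodBd) t
  congr 1
  exact top_hom_ext fun a => by simp [genBd, mul_assoc]

/-- The Peiffer identity in the coproduct. The `t` for which it holds against every `s` form a
subgroup, and for a generator `t` it is an equality of homomorphisms in `s`. -/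
theorem coprod_peiffer (t s : CoprodTop X) : coprodBd t • s = t * s * t⁻¹ := by
  let H : Subgroup (CoprodTop X) :=
    { carrier := {t | ∀ s : CoprodTop X, coprodBd t • s = t * s * t⁻¹}
      one_mem' := fun s => by simp
      mul_mem' := fun {a b} ha hb s => by
        rw [map_mul, mul_smul, hb, ha]
        simp [mul_assoc]
      inv_mem' := fun {a} ha s => by
        rw [map_inv, inv_smul_eq_iff, ha]
        simp [mul_assoc] }
  refine PresentedGroup.generated_by _ H (fun a s => ?_) t s
  change translate (coprodBd (topOf a)) s = (MulAut.conj (topOf a)).toMonoidHom s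
  congr 1
  exact top_hom_ext fun c => by simp [topOf_peiffer]

variable (X) in
/-- The coproduct of a family of crossed modules. -/
def coprod : XMod.{u} where
  T₁ := CoprodTop X
  T₂ := CoprodBase X
  bd := coprodBd
  bd_smul := coprodBd_smul
  peiffer := coprod_peiffer

/-- The inclusions into the coproduct. -/
def coprodIncl (i : ι) : X i ⟶ coprod X :=
  Hom.mk (N := X i) (M := coprod X)
    (MonoidHom.mk' (M := (X i).T₁) (G := CoprodTop X) (fun x => topOf (1, ⟨i, x⟩))
      (fun x y => (topOf_mul 1 i x y).symm))
    (baseOf i)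
    (fun t => by
      change coprodBd (topOf (1, ⟨i, t⟩)) = baseOf i ((X i).bd t)
      simp [genBd])
    (fun b t => by
      change topOf (1, ⟨i, b • t⟩) = baseOf i b • topOf (1, ⟨i, t⟩)
      rw [smul_topOf, ← topOf_smul, one_mul, mul_one])

section Desc

variable {T : XMod.{u}} (h : ∀ i, X i ⟶ T)

/-- The morphism out of the coproduct on base groups. -/
def descBase : CoprodBase X →* T.T₂ := 
  Monoid.CoprodI.lift (M := fun i => (X i).T₂) fun i => Hom.hom₂ (h i)

@[simp]
theorem descBase_of (i : ι) (b : (X i).T₂) :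
    descBase h (baseOf i b) = Hom.hom₂ (h i) b :=
  Monoid.CoprodI.lift_of (M := fun i => (X i).T₂) _ b

theorem descBase_genBd (a : CoprodGen X) :
    descBase h (genBd a) = T.bd (descBase h a.1 • Hom.hom₁ (h a.2.1) a.2.2) := by
  simp [genBd, bd_smul, Hom.bd_comm]

/-- The morphism out of the coproduct on top groups. -/
def descTop : CoprodTop X →* T.T₁ :=
  topLift (fun a => descBase h a.1 • Hom.hom₁ (h a.2.1) a.2.2)
    (fun g i x y => by simp)
    (fun g i b x => by simp [mul_smul, Hom.map_smul])
    (fun a c => by rw [← T.peiffer, map_mul, mul_smul, descBase_genBd])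

@[simp]
theorem descTop_topOf (a : CoprodGen X) :
    descTop h (topOf a) = descBase h a.1 • Hom.hom₁ (h a.2.1) a.2.2 :=
  topLift_topOf ..

/-- The morphism out of the coproduct induced by a family of morphisms. -/
def coprodDesc : coprod X ⟶ T :=
  Hom.mk (N := coprod X) (M := T) (descTop h) (descBase h)
    (fun t => by
      change (T.bd.comp (descTop h)) t = ((descBase h).comp coprodBd) t
      congr 1
      exact top_hom_ext fun a => by simp [descBase_genBd])
    (fun (b : CoprodBase X) (t : CoprodTop X) => by
      change ((descTop h).comp (translate b)) t =
        ((MulDistribMulAction.toMonoidHom T.T₁ (descBase h b)).comp (descTop h)) t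
      congr 1
      exact top_hom_ext fun a => by simp [mul_smul])

theorem coprodIncl_desc (i : ι) : coprodIncl i ≫ coprodDesc h = h i :=
  hom_ext
    (fun x => by
      change descTop h (topOf (1, ⟨i, x⟩)) = _
      simp)
    (fun b => descBase_of h i b)

end Desc

theorem coprod_hom_ext {T : XMod.{u}} {k l : coprod X ⟶ T}
    (hkl : ∀ i, coprodIncl i ≫ k = coprodIncl i ≫ l) : k = l := by
  have h₂ : Hom.hom₂ k = Hom.hom₂ l :=
    Monoid.CoprodI.ext_hom (M := fun i => (X i).T₂) _ _ fun i => congrArg Hom.hom₂ (hkl i)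
  have h₁ : Hom.hom₁ k = Hom.hom₁ l := by
    refine top_hom_ext (X := X) fun a => ?_
    have e : (topOf a : CoprodTop X) = a.1 • topOf (1, a.2) := by simp
    have hk := Hom.map_smul k a.1 (topOf (1, a.2) : CoprodTop X)
    have hl := Hom.map_smul l a.1 (topOf (1, a.2) : CoprodTop X)
    have hi : Hom.hom₁ k (topOf (1, a.2) : CoprodTop X) =
        Hom.hom₁ l (topOf (1, a.2) : CoprodTop X) :=
      congrArg (fun g => Hom.hom₁ g a.2.2) (hkl a.2.1)
    rw [e]
    rw [hi, h₂] at hk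
    exact hk.trans hl.symm
  exact Hom.ext h₁ h₂

variable (X) in
/-- The universal property of the coproduct. -/
def coprodIsColimit : Limits.IsColimit (Limits.Cofan.mk (coprod X) (coprodIncl (X := X))) :=
  Limits.Cofan.IsColimit.mk _ (fun t => coprodDesc t.inj) (fun t j => coprodIncl_desc t.inj j)
    (fun t _ hm => coprod_hom_ext fun i => (hm i).trans (coprodIncl_desc t.inj i).symm)

end Coproduct

/-! ### Crossed modules of bounded size -/

/-- The crossed module structure carried over to two types in bijection with its groups. -/
def transport (T : XMod.{u}) {S₁ S₂ : Type u} (e₁ : T.T₁ ≃ S₁) (e₂ : T.T₂ ≃ S₂) : XMod.{u} :=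
  letI := e₁.symm.group
  letI := e₂.symm.group
  { T₁ := S₁
    T₂ := S₂
    action :=
      { smul := fun b t => e₁ (e₂.symm b • e₁.symm t)
        one_smul := fun t => by
          change e₁ (e₂.symm (e₂ 1) • e₁.symm t) = t
          simp
        mul_smul := fun b c t => by
          change e₁ (e₂.symm (e₂ (e₂.symm b * e₂.symm c)) • e₁.symm t) =
            e₁ (e₂.symm b • e₁.symm (e₁ (e₂.symm c • e₁.symm t)))
          simp [mul_smul]
        smul_mul := fun b s t => by
          change e₁ (e₂.symm b • e₁.symm (e₁ (e₁.symm s * e₁.symm t))) =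
            e₁ (e₁.symm (e₁ (e₂.symm b • e₁.symm s)) * e₁.symm (e₁ (e₂.symm b • e₁.symm t)))
          simp
        smul_one := fun b => by
          change e₁ (e₂.symm b • e₁.symm (e₁ 1)) = e₁ 1
          simp }
    bd := (e₂.symm.mulEquiv.symm.toMonoidHom.comp T.bd).comp e₁.symm.mulEquiv.toMonoidHom
    bd_smul := fun b t => by
      change e₂ (T.bd (e₁.symm (e₁ (e₂.symm b • e₁.symm t)))) =
        e₂ (e₂.symm (e₂ (e₂.symm b * e₂.symm (e₂ (T.bd (e₁.symm t))))) *
          e₂.symm (e₂ (e₂.symm b)⁻¹))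
      simp [bd_smul]
    peiffer := fun t s => by
      change e₁ (e₂.symm (e₂ (T.bd (e₁.symm t))) • e₁.symm s) =
        e₁ (e₁.symm (e₁ (e₁.symm t * e₁.symm s)) * e₁.symm (e₁ (e₁.symm t)⁻¹))
      simp [peiffer] }

/-- The isomorphism onto the transported structure. -/
def transportIso (T : XMod.{u}) {S₁ S₂ : Type u} (e₁ : T.T₁ ≃ S₁) (e₂ : T.T₂ ≃ S₂) :
    T ≅ T.transport e₁ e₂ where
  hom := Hom.mk (N := T) (M := T.transport e₁ e₂)
    (letI := e₁.symm.group; e₁.symm.mulEquiv.symm.toMonoidHom)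
    (letI := e₂.symm.group; e₂.symm.mulEquiv.symm.toMonoidHom)
    (fun t => congrArg (fun x => e₂ (T.bd x)) (e₁.symm_apply_apply t))
    (fun b t => by
      change e₁ (b • t) = e₁ (e₂.symm (e₂ b) • e₁.symm (e₁ t))
      simp)
  inv := Hom.mk (N := T.transport e₁ e₂) (M := T)
    (letI := e₁.symm.group; e₁.symm.mulEquiv.toMonoidHom)
    (letI := e₂.symm.group; e₂.symm.mulEquiv.toMonoidHom)
    (fun t => (e₂.symm_apply_apply (T.bd (e₁.symm t))).symm)
    (fun b t => e₁.symm_apply_apply (e₂.symm b • e₁.symm t))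
  hom_inv_id := hom_ext (fun t => e₁.symm_apply_apply t) (fun t => e₂.symm_apply_apply t)
  inv_hom_id := hom_ext (fun t => e₁.apply_symm_apply t) (fun t => e₂.apply_symm_apply t)

/-- Structures of a crossed module on a fixed pair of types. -/
def Structure (S₁ S₂ : Type u) : Type u :=
  Σ' (_ : Group S₁) (_ : Group S₂) (_ : MulDistribMulAction S₂ S₁) (bd : S₁ →* S₂),
    (∀ (b : S₂) (t : S₁), bd (b • t) = b * bd t * b⁻¹) ∧ ∀ t s : S₁, bd t • s = t * s * t⁻¹

/-- The crossed module given by a structure on a pair of types. -/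
def Structure.toXMod {S₁ S₂ : Type u} (σ : Structure S₁ S₂) : XMod.{u} :=
  letI := σ.1
  letI := σ.2.1
  letI := σ.2.2.1
  { T₁ := S₁, T₂ := S₂, bd := σ.2.2.2.1, bd_smul := σ.2.2.2.2.1, peiffer := σ.2.2.2.2.2 }

/-- Every crossed module whose groups have at most `c` elements is isomorphic to one with groups
carried by subsets of a fixed set with `c` elements. -/
theorem exists_structure_iso (c : Cardinal.{u}) (T : XMod.{u}) (h₁ : Cardinal.mk T.T₁ ≤ c)
    (h₂ : Cardinal.mk T.T₂ ≤ c) :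
    ∃ (S : Set c.out × Set c.out) (σ : Structure S.1 S.2), Nonempty (T ≅ σ.toXMod) := by
  rw [← c.mk_out, Cardinal.le_def] at h₁ h₂
  obtain ⟨e₁⟩ := h₁
  obtain ⟨e₂⟩ := h₂
  let f₁ := Equiv.ofInjective e₁ e₁.injective
  let f₂ := Equiv.ofInjective e₂ e₂.injective
  let M := T.transport f₁ f₂
  exact ⟨(Set.range e₁, Set.range e₂),
    ⟨M.group₁, M.group₂, M.action, M.bd, M.bd_smul, M.peiffer⟩, ⟨T.transportIso f₁ f₂⟩⟩

/-- The crossed modules with a given property have only a small set of isomorphism classes if the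
property bounds the size of their groups. -/
theorem small_isoClasses (P : XMod.{u} → Prop) (c : Cardinal.{u})
    (hP : ∀ T, P T → Cardinal.mk T.T₁ ≤ c ∧ Cardinal.mk T.T₂ ≤ c) :
    Small.{u} (Quotient
      ((isIsomorphicSetoid XMod.{u}).comap (Subtype.val : {T // P T} → XMod))) := by
  choose S σ e using fun T : {T // P T} =>
    exists_structure_iso c T.1 (hP T.1 T.2).1 (hP T.1 T.2).2
  let F : Quotient ((isIsomorphicSetoid XMod.{u}).comap (Subtype.val : {T // P T} → XMod)) →
      Σ S : Set c.out × Set c.out, Structure S.1 S.2 := fun q => ⟨S q.out, σ q.out⟩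
  refine small_of_injective (f := F) fun q r hqr => ?_
  have key : (σ q.out).toXMod = (σ r.out).toXMod :=
    congrArg (fun s : Σ S : Set c.out × Set c.out, Structure S.1 S.2 => s.2.toXMod) hqr
  rw [← q.out_eq, ← r.out_eq]
  obtain ⟨i⟩ := e q.out
  obtain ⟨j⟩ := e r.out
  exact Quotient.sound ⟨i ≪≫ eqToIso key ≪≫ j.symm⟩

/-- A group generated by a set `S` has at most `max #S ℵ₀` elements. -/
theorem mk_le_of_closure_eq_top {G : Type u} [Group G] {S : Set G}
    (hS : Subgroup.closure S = ⊤) : Cardinal.mk G ≤ max (Cardinal.mk S) Cardinal.aleph0 := by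
  -- Every element of `G` is the value of a word in the letters `s` and `s⁻¹` with `s ∈ S`.
  have hsurj : Function.Surjective fun l : List (S × Bool) =>
      FreeGroup.lift (Subtype.val : S → G) (FreeGroup.mk l) := by
    intro g
    have hg : g ∈ (FreeGroup.lift (Subtype.val : S → G)).range := by
      rw [FreeGroup.range_lift_eq_closure, Subtype.range_coe, hS]
      trivial
    obtain ⟨w, rfl⟩ := hg
    obtain ⟨l, rfl⟩ := Quot.exists_rep w
    exact ⟨l, rfl⟩
  refine (Cardinal.mk_le_of_surjective hsurj).trans ((Cardinal.mk_list_le_max _).trans ?_)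
  refine max_le (le_max_right _ _) ?_
  rw [Cardinal.mk_prod, Cardinal.lift_uzero]
  refine (Cardinal.mul_le_max _ _).trans (max_le (max_le (le_max_left _ _) ?_) (le_max_right _ _))
  simp

theorem HasGenerators.mk_le {T : XMod.{u}} {n κ : Cardinal.{u}} (hT : T.HasGenerators n)
    (hκ : Cardinal.aleph0 ≤ κ) (hn : n ≤ κ) : Cardinal.mk T.T₁ ≤ κ ∧ Cardinal.mk T.T₂ ≤ κ := by
  obtain ⟨S₁, S₂, h₁, h₂, rfl⟩ := hT
  exact ⟨(mk_le_of_closure_eq_top h₁).trans (max_le (le_self_add.trans hn) hκ),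
    (mk_le_of_closure_eq_top h₂).trans (max_le (le_add_self.trans hn) hκ)⟩

theorem hasGenerators_mk (T : XMod.{u}) :
    T.HasGenerators (Cardinal.mk T.T₁ + Cardinal.mk T.T₂) :=
  ⟨Set.univ, Set.univ, Subgroup.closure_univ, Subgroup.closure_univ, by simp⟩

/-- The kernel of a morphism out of a crossed module with at most `κ` generators, `κ` infinite, has
fewer than `2 ^ κ` generators, since it has at most `κ` elements. -/
theorem ker_hasGenerators {N M : XMod.{u}} (p : N ⟶ M) {n κ : Cardinal.{u}}
    (hN : N.HasGenerators n) (hκ : Cardinal.aleph0 ≤ κ) (hn : n ≤ κ) :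
    ∃ m < 2 ^ κ, (ker p).HasGenerators m := by
  obtain ⟨h₁, h₂⟩ := hN.mk_le hκ hn
  refine ⟨_, lt_of_le_of_lt ?_ (Cardinal.cantor κ), (ker p).hasGenerators_mk⟩
  calc Cardinal.mk (Hom.hom₁ p).ker + Cardinal.mk (Hom.hom₂ p).ker ≤ κ + κ :=
        add_le_add ((Cardinal.mk_subtype_le _).trans h₁) ((Cardinal.mk_subtype_le _).trans h₂)
    _ = κ := Cardinal.add_eq_self hκ

/-! ### Local objects and acyclic crossed modules -/

namespace LocalizationFunctor

variable {Λ : LocalizationFunctor.{u}}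

theorem locMap_naturality {N M : XMod.{u}} (g : N ⟶ M) :
    g ≫ Λ.locMap M = Λ.locMap N ≫ Λ.L.map g :=
  Λ.ell.naturality g

theorem IsAcyclic.hom_eq_trivialHom {X T : XMod.{u}} (hX : Λ.IsAcyclic X) (hT : Λ.IsLocal T)
    (h : X ⟶ T) : h = trivialHom X T := by
  have : IsIso (Λ.locMap T) := hT
  obtain ⟨i⟩ := hX
  have e : h = Λ.locMap X ≫ Λ.L.map h ≫ inv (Λ.locMap T) := by
    rw [← Category.assoc, ← locMap_naturality, Category.assoc, IsIso.hom_inv_id, Category.comp_id]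
  rw [e, comp_eq_trivialHom_of_iso_one i]

/-- If `g` is an `L`-equivalence and the localization maps of its source and target are
epimorphisms through which every morphism to `T` factors, then `T` is `g`-local. -/
theorem isLocalFor_of_factor {B C T : XMod.{u}} {g : B ⟶ C} (hg : Λ.IsEquivalence g)
    [Epi (Λ.locMap B)] (hB : ∀ h : B ⟶ T, ∃ k, Λ.locMap B ≫ k = h)
    (hC : ∀ h : C ⟶ T, ∃ k, Λ.locMap C ≫ k = h) : IsLocalFor g T := by
  have : IsIso (Λ.L.map g) := hg
  constructor
  · intro h h' e
    obtain ⟨k, rfl⟩ := hC h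
    obtain ⟨k', rfl⟩ := hC h'
    simp only [← Category.assoc, locMap_naturality] at e
    simp only [Category.assoc, cancel_epi] at e
    rw [e]
  · intro h
    obtain ⟨k, rfl⟩ := hB h
    exact ⟨Λ.locMap C ≫ inv (Λ.L.map g) ≫ k, by
      simp only [← Category.assoc, locMap_naturality]
      simp⟩

/-- A localization functor at `f` whose local objects are the `g`-local ones is the localization
functor at `g`. -/
theorem IsLocalizationAt.of_isLocalFor_iff {B C B' C' : XMod.{u}} {f : B ⟶ C} {g : B' ⟶ C'}
    (hf : Λ.IsLocalizationAt f) (h : ∀ T, IsLocalFor f T ↔ IsLocalFor g T) :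
    Λ.IsLocalizationAt g where
  isLocal_iff T := (hf.isLocal_iff T).trans (h T)
  isEquivalence_iff k := by
    rw [hf.isEquivalence_iff k]
    exact forall_congr' fun T => by rw [h T]

theorem IsLocalizationAt.isEquivalence {B C : XMod.{u}} {f : B ⟶ C}
    (hf : Λ.IsLocalizationAt f) : Λ.IsEquivalence f :=
  (hf.isEquivalence_iff f).2 fun _ hT => hT

variable (Λ) in
/-- The coproduct of representatives of the acyclic crossed modules with fewer than `c` generators
exists: there is only a set of them up to isomorphism. -/
theorem exists_isCoproductOfAcyclics {c : Cardinal.{u}} (hc : Cardinal.aleph0 ≤ c) :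
    ∃ A : XMod.{u}, Λ.IsCoproductOfAcyclics c A := by
  let P : XMod.{u} → Prop := fun T => Λ.IsAcyclic T ∧ ∃ n < c, T.HasGenerators n
  let Q := Quotient ((isIsomorphicSetoid XMod.{u}).comap (Subtype.val : {T // P T} → XMod))
  have : Small.{u} Q := small_isoClasses P c fun T hT => by
    obtain ⟨-, n, hn, hT⟩ := hT
    exact hT.mk_le hc hn.le
  let X : Shrink.{u} Q → XMod.{u} := fun i => ((equivShrink Q).symm i).out.1
  refine ⟨coprod X, Shrink.{u} Q, X, coprodIncl, fun i => ((equivShrink Q).symm i).out.2,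
    fun T hT hT' => ?_, ⟨coprodIsColimit X⟩⟩
  let q : Q := Quotient.mk _ ⟨T, hT, hT'⟩
  refine ⟨equivShrink Q q, ?_, fun j hj => ?_⟩
  · have hq : Nonempty (q.out.1 ≅ T) := Quotient.mk_out (s := (isIsomorphicSetoid XMod.{u}).comap
      (Subtype.val : {T // P T} → XMod)) ⟨T, hT, hT'⟩
    simp only [X, Equiv.symm_apply_apply]
    exact hq.map Iso.symm
  · rw [← Equiv.symm_apply_eq, ← ((equivShrink Q).symm j).out_eq]
    exact Quotient.sound (hj.map Iso.symm)

/-- If `A` is the coproduct of the acyclic crossed modules with fewer than `c` generators, the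
`A ⟶ 1`-local crossed modules are those receiving only trivial morphisms from them. -/
theorem IsCoproductOfAcyclics.isLocalFor_toOne_iff {c : Cardinal.{u}} {A T : XMod.{u}}
    (hA : Λ.IsCoproductOfAcyclics c A) :
    IsLocalFor (toOne A) T ↔ ∀ Y : XMod.{u}, Λ.IsAcyclic Y → (∃ n < c, Y.HasGenerators n) →
      ∀ h : Y ⟶ T, h = trivialHom Y T := by
  classical
  obtain ⟨ι, X, incl, hX, hcover, ⟨hcolim⟩⟩ := hA
  rw [XMod.isLocalFor_toOne_iff]
  constructor
  · intro hT Y hY hn h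
    obtain ⟨i, ⟨e⟩, -⟩ := hcover Y hY hn
    -- The morphism from the coproduct that is `h` on the summand `X i` and trivial elsewhere.
    let k : ∀ j, X j ⟶ T := Function.update (fun j => trivialHom (X j) T) i (e.inv ≫ h)
    have hfac : incl i ≫ Limits.Cofan.IsColimit.desc hcolim k = k i :=
      Limits.Cofan.IsColimit.fac hcolim k i
    have hk : k i = e.inv ≫ h := Function.update_self ..
    rw [hT (Limits.Cofan.IsColimit.desc hcolim k), comp_trivialHom, hk, eq_comm,
      e.inv_comp_eq] at hfac
    rw [hfac, comp_trivialHom]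
  · intro hT h
    refine Limits.Cofan.IsColimit.hom_ext hcolim _ _ fun i => ?_
    change incl i ≫ h = incl i ≫ trivialHom A T
    rw [comp_trivialHom]
    exact hT _ (hX i).1 (hX i).2 _

end LocalizationFunctor

end XMod

theorem mainTheorem5 {B C : XMod.{u}} (f : B ⟶ C)
    (Λ : XMod.LocalizationFunctor.{u})
    (hf : Λ.IsLocalizationAt f)
    (hreg : Λ.IsRegularEpiLocalization)
    (hker : ∀ T : XMod.{u}, Λ.IsAcyclic (XMod.ker (Λ.locMap T)))
    (b c κ : Cardinal.{u})
    (hb : B.HasGenerators b) (hc : C.HasGenerators c)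
    (hκ : Cardinal.aleph0 ≤ κ) (hbc : b + c ≤ κ) :
    ∃ A : XMod.{u}, Λ.IsCoproductOfAcyclics (2 ^ κ) A ∧ Λ.IsNullification A := by
  obtain ⟨A, hA⟩ := Λ.exists_isCoproductOfAcyclics (hκ.trans (Cardinal.cantor κ).le)
  refine ⟨A, hA, hf.of_isLocalFor_iff fun T => ?_⟩
  rw [hA.isLocalFor_toOne_iff]
  constructor
  · intro hT Y hY _ h
    exact hY.hom_eq_trivialHom ((hf.isLocal_iff T).2 hT) h
  · intro hT
    have hfac : ∀ (N : XMod.{u}) (n : Cardinal.{u}), N.HasGenerators n → n ≤ κ →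
        ∀ h : N ⟶ T, ∃ k, Λ.locMap N ≫ k = h := by
      intro N n hN hn h
      have := hreg N
      exact XMod.exists_factor_of_kerHom_comp_eq _ h
        (hT _ (hker N) (XMod.ker_hasGenerators _ hN hκ hn) _)
    have := hreg B
    exact XMod.LocalizationFunctor.isLocalFor_of_factor hf.isEquivalence
      (hfac B b hb (le_self_add.trans hbc)) (hfac C c hc (le_add_self.trans hbc))
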